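/- Let $Z$ be a complete separable metric space with its Borel $\sigma$-field, let $\nu$ be a $\sigma$-finite measure on $Z$, let $a,b\ge 0$ be integers and let $\Theta=\mathbb R^{a}\times\mathbb R^{b}=\mathbb R^{a+b}$ with the Euclidean norm $\|\cdot\|$. For every $\theta\in\Theta$ let $P_{Z|\theta}$ be a probability measure on $Z$ with density $p(\cdot|\theta)\ge 0$ with respect to $\nu$, and suppose that the model is smooth in the sense that for $\nu$-almost every $z$ the function $\theta\mapsto p(z|\theta)$ is differentiable on $\Theta$. Suppose that 1. the map $P_{Z|\theta}\mapsto\theta$ is continuous with respect to weak convergence, i.e. $P_{Z|\theta}\to P_{Z|\theta_0}$ weakly implies $\theta\to\theta_0$; 2. the Fisher information matrix $$J(\theta)=\mathbb E_{Z|\theta}\left[\frac{\partial}{\partial\theta_i}\log p(z|\theta)\,\frac{\partial}{\partial\theta_j}\log p(z|\theta)\right]_{i,j=1,\dots,a+b}$$ exists (all these expectations are finite) and is positive definite for every $\theta\in\Theta$, and its entries are locally bounded functions of $\theta$ (as they are if $J$ is continuous). Put $\Delta_H(\theta,\theta')=\int_Z\bigl(\sqrt{p(z|\theta)}-\sqrt{p(z|\theta')}\bigr)^2\,d\nu(z)$.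 Then $\Delta_H^{1/2}$ is locally dominated by $\|\cdot\|$ on $\Theta$: for every $\theta\in\Theta$ there exist $\varepsilon,c,c'>0$ such that for all $\theta'\in\Theta$ with $\Delta_H^{1/2}(\theta,\theta')\le\varepsilon$, $$c\,\|\theta-\theta'\|\le\Delta_H^{1/2}(\theta,\theta')\le c'\,\|\theta-\theta'\|.$$ -/

import Mathlib

open MeasureTheory Filter Topology

noncomputable section

/-- `P` is the family of laws `θ ↦ P_{Z|θ}` and `p θ z = p(z|θ)` is a version of the density
`dP_{Z|θ}/dν`. -/
def IsDensityFamily {Z Θ : Type*} [MeasurableSpace Z] (ν : Measure Z)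
    (P : Θ → ProbabilityMeasure Z) (p : Θ → Z → ℝ) : Prop :=
  (∀ θ, Measurable (p θ)) ∧ (∀ θ z, 0 ≤ p θ z) ∧
    ∀ θ, (P θ : Measure Z) = ν.withDensity (fun z => ENNReal.ofReal (p θ z))

/-- The squared Hellinger distance `Δ_H(θ, θ') = ∫ (√p(z|θ) - √p(z|θ'))² dν(z)`. -/
def hellingerSq {Z Θ : Type*} [MeasurableSpace Z] (ν : Measure Z) (p : Θ → Z → ℝ)
    (θ θ' : Θ) : ℝ :=
  ∫ z, (√(p θ z) - √(p θ' z)) ^ 2 ∂ν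

/-- The `i`-th component `∂/∂θ_i log p(z|θ)` of the score. -/
def score {Z : Type*} {d : ℕ} (p : EuclideanSpace ℝ (Fin d) → Z → ℝ)
    (θ : EuclideanSpace ℝ (Fin d)) (i : Fin d) (z : Z) : ℝ :=
  lineDeriv ℝ (fun t => Real.log (p t z)) θ (EuclideanSpace.single i 1)

/-- The Fisher information matrix `J(θ) = E_{Z|θ} [∂_i log p(z|θ) ∂_j log p(z|θ)]_{i,j}`. -/
def fisherMatrix {Z : Type*} [MeasurableSpace Z] {d : ℕ}
    (P : EuclideanSpace ℝ (Fin d) → ProbabilityMeasure Z)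
    (p : EuclideanSpace ℝ (Fin d) → Z → ℝ) (θ : EuclideanSpace ℝ (Fin d)) :
    Matrix (Fin d) (Fin d) ℝ :=
  Matrix.of fun i j => ∫ z, score p θ i z * score p θ j z ∂(P θ : Measure Z)

/-- All the expectations that define the Fisher information matrix at `θ` exist
(they are finite Lebesgue integrals). -/
def FisherMatrixExists {Z : Type*} [MeasurableSpace Z] {d : ℕ}
    (P : EuclideanSpace ℝ (Fin d) → ProbabilityMeasure Z)
    (p : EuclideanSpace ℝ (Fin d) → Z → ℝ) (θ : EuclideanSpace ℝ (Fin d)) : Prop :=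
  ∀ i j, Integrable (fun z => score p θ i z * score p θ j z) (P θ : Measure Z)

/-- The map `P_{Z|θ} ↦ θ` is continuous for weak convergence: `P_{Z|θ} → P_{Z|θ₀}` weakly
implies `θ → θ₀`. (With a constant sequence this contains the injectivity of `θ ↦ P_{Z|θ}`,
so that the map is well defined. Weak convergence of probability measures on a separable metric
space is metrizable, so sequences suffice.) -/
def InverseWeaklyContinuous {Z Θ : Type*} [MeasurableSpace Z] [TopologicalSpace Z]
    [OpensMeasurableSpace Z] [TopologicalSpace Θ] (P : Θ → ProbabilityMeasure Z) : Prop :=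
  ∀ (θ₀ : Θ) (u : ℕ → Θ), Tendsto (fun n => P (u n)) atTop (𝓝 (P θ₀)) → Tendsto u atTop (𝓝 θ₀)

/-- The metric `ρ'` locally dominates the metric `ρ`: around every `x` there is a ball
*for the metric `ρ`* on which `ρ(x, ·)` and `ρ'(x, ·)` agree up to constant factors. -/
def LocallyDominates {X : Type*} (ρ' ρ : X → X → ℝ) : Prop :=
  ∀ x, ∃ ε c c' : ℝ, 0 < ε ∧ 0 < c ∧ 0 < c' ∧
    ∀ x', ρ x x' ≤ ε → c * ρ' x x' ≤ ρ x x' ∧ ρ x x' ≤ c' * ρ' x x'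

end

/-! ### Energy of a square root on the unit interval. -/

open scoped ENNReal

/-! `√(hellingerSq)` is the L²(ν) distance between square roots of densities, and the formal
derivative of `√p` in direction `h` has squared L² norm `hᵀ J h / 4`.

Upper bound: the fundamental theorem of calculus, Cauchy–Schwarz and Tonelli bound `hellingerSq` by
this energy averaged over the segment (`lintegral_sq_sqrt_sub_sqrt_le`); local boundedness of `J`
finishes.

Lower bound (`exists_mul_norm_sq_le_hellingerSq`): if it failed, some `h n → 0` would have squared
Hellinger distance `o(‖h n‖²)`. For a limit `v` of the unit directions, Fatou gives `vᵀ J v / 4 ≤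
0`, against positive definiteness. One inequality suffices, so differentiability in quadratic mean
is not needed.

Both bounds live on Euclidean neighbourhoods, while the claim concerns Hellinger balls. Hellinger
convergence implies L¹, hence weak, convergence, so inverse weak continuity puts small Hellinger
balls inside any such neighbourhood. -/

theorem abs_sqrt_add_sub_sqrt_add_le_integral {q q' : ℝ → ℝ} (hq : ∀ t, 0 ≤ q t)
    (hd : ∀ t, HasDerivAt q (q' t) t)
    (hint : IntegrableOn (fun t => |q' t| / (2 * √(q t))) (Set.Ioc 0 1)) {ε : ℝ} (hε : 0 < ε) :
    |√(q 1 + ε) - √(q 0 + ε)| ≤ ∫ t in Set.Ioc 0 1, |q' t| / (2 * √(q t)) := by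
  have hpos (t : ℝ) : 0 < q t + ε := add_pos_of_nonneg_of_pos (hq t) hε
  have hderiv (t : ℝ) : HasDerivAt (fun t => √(q t + ε)) (q' t / (2 * √(q t + ε))) t :=
    ((hd t).add_const ε).sqrt (hpos t).ne'
  have hbound (t : ℝ) : ‖q' t / (2 * √(q t + ε))‖ ≤ |q' t| / (2 * √(q t)) := by
    have hs : 0 < √(q t + ε) := Real.sqrt_pos.2 (hpos t)
    rw [Real.norm_eq_abs, abs_div, abs_of_pos (by positivity : 0 < 2 * √(q t + ε))]
    rcases (hq t).eq_or_lt with h0 | h0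
    -- A zero of `q` is a minimum, so `q'` vanishes there; hence the value `0` that division by zero
    -- gives the right side is harmless.
    · have hmin : IsLocalMin q t := Eventually.of_forall fun s => h0 ▸ hq s
      have : q' t = 0 := hmin.hasDerivAt_eq_zero (hd t)
      simp [this]
    · have : 0 < √(q t) := Real.sqrt_pos.2 h0
      have : √(q t) ≤ √(q t + ε) := Real.sqrt_le_sqrt (by linarith)
      gcongr
  have hq'meas : Measurable q' := by
    have : q' = deriv q := funext fun t => (hd t).deriv.symm
    exact this ▸ measurable_deriv q
  have hqcont : Continuous q := continuous_iff_continuousAt.2 fun t => (hd t).continuousAt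
  have hint' : IntegrableOn (fun t => q' t / (2 * √(q t + ε))) (Set.Ioc 0 1) := by
    refine hint.mono' ?_ (Eventually.of_forall hbound)
    exact (hq'meas.div (by fun_prop)).aestronglyMeasurable
  have hftc := intervalIntegral.integral_eq_sub_of_hasDerivAt
    (fun t _ => hderiv t) ((intervalIntegrable_iff_integrableOn_Ioc_of_le zero_le_one).2 hint')
  rw [← hftc, intervalIntegral.integral_of_le zero_le_one, ← Real.norm_eq_abs]
  exact norm_integral_le_of_norm_le hint (Eventually.of_forall hbound)

/-- Since `√q` may fail to be differentiable at zeros of `q`, the bound is obtained from `√(q + ε)`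
as `ε → 0`. -/
theorem abs_sqrt_sub_sqrt_le_integral {q q' : ℝ → ℝ} (hq : ∀ t, 0 ≤ q t)
    (hd : ∀ t, HasDerivAt q (q' t) t)
    (hint : IntegrableOn (fun t => |q' t| / (2 * √(q t))) (Set.Ioc 0 1)) :
    |√(q 1) - √(q 0)| ≤ ∫ t in Set.Ioc 0 1, |q' t| / (2 * √(q t)) := by
  have hlim : Tendsto (fun ε => |√(q 1 + ε) - √(q 0 + ε)|) (𝓝[>] 0)
      (𝓝 |√(q 1 + 0) - √(q 0 + 0)|) := by
    have : Continuous fun ε => |√(q 1 + ε) - √(q 0 + ε)| := by fun_prop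
    exact (this.tendsto 0).mono_left nhdsWithin_le_nhds
  simp only [add_zero] at hlim
  exact le_of_tendsto hlim (eventually_mem_nhdsWithin.mono fun ε hε =>
    abs_sqrt_add_sub_sqrt_add_le_integral hq hd hint hε)

theorem ofReal_sq_sqrt_sub_sqrt_le_lintegral {q q' : ℝ → ℝ} (hq : ∀ t, 0 ≤ q t)
    (hd : ∀ t, HasDerivAt q (q' t) t) :
    ENNReal.ofReal ((√(q 0) - √(q 1)) ^ 2) ≤
      ∫⁻ t in Set.Ioc 0 1, ENNReal.ofReal (q' t ^ 2 / (4 * q t)) := by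
  -- Infinite energy makes the bound trivial; finite energy supplies the integrability used below.
  rcases eq_or_ne (∫⁻ t in Set.Ioc 0 1, ENNReal.ofReal (q' t ^ 2 / (4 * q t))) ∞ with htop | htop
  · simp [htop]
  have hq'meas : Measurable q' := by
    have : q' = deriv q := funext fun t => (hd t).deriv.symm
    exact this ▸ measurable_deriv q
  have hqcont : Continuous q := continuous_iff_continuousAt.2 fun t => (hd t).continuousAt
  set f : ℝ → ℝ := fun t => |q' t| / (2 * √(q t)) with hf
  have hfmeas : Measurable f := hq'meas.abs.div (by fun_prop)
  have hfsq (t : ℝ) : f t ^ 2 = q' t ^ 2 / (4 * q t) := by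
    simp only [hf, div_pow, mul_pow, sq_abs, Real.sq_sqrt (hq t)]
    norm_num
  have hnonneg (t : ℝ) : 0 ≤ q' t ^ 2 / (4 * q t) := hfsq t ▸ sq_nonneg _
  set μ : Measure ℝ := volume.restrict (Set.Ioc 0 1) with hμ
  have : IsProbabilityMeasure μ := ⟨by simp [hμ]⟩
  have hsq : Integrable (fun t => f t ^ 2) μ := by
    refine ⟨(hfmeas.pow_const 2).aestronglyMeasurable, ?_⟩
    rw [hasFiniteIntegral_iff_ofReal (Eventually.of_forall fun t => sq_nonneg _)]
    simpa only [hfsq] using htop.lt_top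
  have hmem : MemLp f 2 μ := (memLp_two_iff_integrable_sq hfmeas.aestronglyMeasurable).2 hsq
  have hint : Integrable f μ := hmem.integrable (by norm_num)
  -- Cauchy–Schwarz `(∫ f)² ≤ ∫ f²` on the unit interval, as nonnegativity of a variance.
  have hvar := ProbabilityTheory.variance_nonneg f μ
  rw [ProbabilityTheory.variance_eq_sub hmem] at hvar
  have hle := abs_sqrt_sub_sqrt_le_integral hq hd hint
  simp only [← hfsq]
  rw [← ofReal_integral_eq_lintegral_ofReal hsq (Eventually.of_forall fun t => sq_nonneg _)]
  refine ENNReal.ofReal_le_ofReal ?_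
  have h1 : (√(q 0) - √(q 1)) ^ 2 ≤ (∫ t, f t ∂μ) ^ 2 := by
    rw [sub_sq_comm, ← sq_abs]
    exact pow_le_pow_left₀ (abs_nonneg _) hle 2
  have h2 : (∫ t, (f ^ 2) t ∂μ) = ∫ t, f t ^ 2 ∂μ := rfl
  linarith

/-! ### Hellinger distance along a segment. -/

section PathIntegral

variable {Z E : Type*} [MeasurableSpace Z] [NormedAddCommGroup E] [NormedSpace ℝ E]

theorem hasDerivAt_comp_segment {f : E → ℝ} (hf : Differentiable ℝ f) (x h : E) (t : ℝ) :
    HasDerivAt (fun t : ℝ => f (x + t • h)) (fderiv ℝ f (x + t • h) h) t := by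
  have h1 : HasDerivAt (fun t : ℝ => x + t • h) h t := by
    simpa using ((hasDerivAt_id t).smul_const h).const_add x
  exact (hf (x + t • h)).hasFDerivAt.comp_hasDerivAt t h1

/-- Joint measurability is what Tonelli needs: the derivative is a limit of difference quotients of
a function continuous in `t` and measurable in `z`. -/
theorem measurable_fderiv_segment {p : E → Z → ℝ} (hp : ∀ x, Measurable (p x))
    (hd : ∀ z, Differentiable ℝ (fun x => p x z)) (x h : E) :
    Measurable (fun w : ℝ × Z => fderiv ℝ (fun y => p y w.2) (x + w.1 • h) h) := by
  have hmeas : Measurable (Function.uncurry fun (t : ℝ) z => p (x + t • h) z) :=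
    measurable_uncurry_of_continuous_of_measurable
      (fun z => (hd z).continuous.comp (by fun_prop)) (fun t => hp _)
  have hu : Tendsto (fun n : ℕ => (1 : ℝ) / (n + 1)) atTop (𝓝[≠] 0) :=
    tendsto_nhdsWithin_iff.2 ⟨tendsto_one_div_add_atTop_nhds_zero_nat,
      Eventually.of_forall fun n => (Nat.one_div_pos_of_nat (α := ℝ)).ne'⟩
  refine measurable_of_tendsto_metrizable
    (f := fun (n : ℕ) (w : ℝ × Z) => ((1 : ℝ) / (n + 1))⁻¹ •
      (p (x + (w.1 + 1 / (n + 1)) • h) w.2 - p (x + w.1 • h) w.2)) (fun n => ?_) ?_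
  · have hstep : Measurable fun w : ℝ × Z => p (x + (w.1 + 1 / ((n : ℝ) + 1)) • h) w.2 :=
      hmeas.comp ((measurable_fst.add_const _).prodMk measurable_snd)
    simp only [smul_eq_mul]
    exact (hstep.sub hmeas).const_mul _
  · rw [tendsto_pi_nhds]
    intro w
    exact (hasDerivAt_iff_tendsto_slope_zero.1 (hasDerivAt_comp_segment (hd w.2) x h w.1)).comp hu

theorem lintegral_sq_sqrt_sub_sqrt_le_of_differentiable {ν : Measure Z} [SFinite ν]
    {p : E → Z → ℝ} (hp : ∀ x, Measurable (p x)) (hp0 : ∀ x z, 0 ≤ p x z)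
    (hd : ∀ z, Differentiable ℝ (fun x => p x z)) (x h : E) :
    ∫⁻ z, ENNReal.ofReal ((√(p x z) - √(p (x + h) z)) ^ 2) ∂ν ≤
      ∫⁻ t in Set.Ioc (0 : ℝ) 1, ∫⁻ z, ENNReal.ofReal
        (fderiv ℝ (fun y => p y z) (x + t • h) h ^ 2 / (4 * p (x + t • h) z)) ∂ν := by
  have hmeas : Measurable (Function.uncurry fun (t : ℝ) z => p (x + t • h) z) :=
    measurable_uncurry_of_continuous_of_measurable
      (fun z => (hd z).continuous.comp (by fun_prop)) (fun t => hp _)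
  rw [lintegral_lintegral_swap]
  · refine lintegral_mono fun z => ?_
    simpa using ofReal_sq_sqrt_sub_sqrt_le_lintegral (fun t => hp0 (x + t • h) z)
      (fun t => hasDerivAt_comp_segment (hd z) x h t)
  · exact (((measurable_fderiv_segment hp hd x h).pow_const 2).div
      (hmeas.const_mul 4)).ennreal_ofReal.aemeasurable

/-- The squared Hellinger distance is at most the energy of the square root of the density along
the segment. -/
theorem lintegral_sq_sqrt_sub_sqrt_le {ν : Measure Z} [SFinite ν]
    {p : E → Z → ℝ} (hp : ∀ x, Measurable (p x)) (hp0 : ∀ x z, 0 ≤ p x z)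
    (hd : ∀ᵐ z ∂ν, Differentiable ℝ (fun x => p x z)) (x h : E) :
    ∫⁻ z, ENNReal.ofReal ((√(p x z) - √(p (x + h) z)) ^ 2) ∂ν ≤
      ∫⁻ t in Set.Ioc (0 : ℝ) 1, ∫⁻ z, ENNReal.ofReal
        (fderiv ℝ (fun y => p y z) (x + t • h) h ^ 2 / (4 * p (x + t • h) z)) ∂ν := by
  -- The differentiability set need not be measurable, so it is shrunk to a measurable conull set,
  -- off which the density is replaced by zero.
  obtain ⟨s, hs, hsm, hsd⟩ : ∃ s, s ∈ ae ν ∧ MeasurableSet s ∧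
      ∀ z ∈ s, Differentiable ℝ (fun x => p x z) := by
    refine ⟨(toMeasurable ν {z | ¬Differentiable ℝ (fun x => p x z)})ᶜ, ?_,
      (measurableSet_toMeasurable _ _).compl, fun z hz => ?_⟩
    · rw [compl_mem_ae_iff, measure_toMeasurable]
      exact ae_iff.1 hd
    · by_contra hc
      exact hz (subset_toMeasurable ν _ hc)
  have hmain := lintegral_sq_sqrt_sub_sqrt_le_of_differentiable (ν := ν)
    (p := fun x => s.indicator (p x)) (fun x => (hp x).indicator hsm)
    (fun x z => Set.indicator_nonneg (fun z _ => hp0 x z) z) (fun z => by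
      by_cases hz : z ∈ s
      · simpa [Set.indicator_of_mem hz] using hsd z hz
      · simp [Set.indicator_of_notMem hz]) x h
  convert hmain using 1
  · refine lintegral_congr_ae ?_
    filter_upwards [hs] with z hz
    simp only [Set.indicator_of_mem hz]
  · refine lintegral_congr fun t => lintegral_congr_ae ?_
    filter_upwards [hs] with z hz
    simp only [Set.indicator_of_mem hz]

end PathIntegral

/-! ### The Fisher information form. -/

section Fisher

variable {Z : Type*} {d : ℕ}

theorem fderiv_eq_sum_score {p : EuclideanSpace ℝ (Fin d) → Z → ℝ} {z : Z}
    {θ : EuclideanSpace ℝ (Fin d)} (hd : DifferentiableAt ℝ (fun t => p t z) θ)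
    (hp : p θ z ≠ 0) (h : EuclideanSpace ℝ (Fin d)) :
    fderiv ℝ (fun t => p t z) θ h = p θ z * ∑ i, h i * score p θ i z := by
  have hs (i : Fin d) : score p θ i z =
      (p θ z)⁻¹ * fderiv ℝ (fun t => p t z) θ (EuclideanSpace.single i 1) := by
    rw [score, (hd.log hp).lineDeriv_eq_fderiv, fderiv.log hd hp]
    simp
  have hh : h = ∑ i, h i • EuclideanSpace.single i (1 : ℝ) := by
    simpa using ((EuclideanSpace.basisFun (Fin d) ℝ).sum_repr h).symm
  conv_lhs => rw [hh]
  simp only [hs, map_sum, map_smul, smul_eq_mul, Finset.mul_sum]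
  refine Finset.sum_congr rfl fun i _ => ?_
  field_simp

/-- The energy of the square root of the density in direction `h` is a quarter of the Fisher
information form at `h`. -/
theorem lintegral_fderiv_sq_div_eq_fisher [MeasurableSpace Z] {ν : Measure Z}
    {P : EuclideanSpace ℝ (Fin d) → ProbabilityMeasure Z}
    {p : EuclideanSpace ℝ (Fin d) → Z → ℝ} (hPp : IsDensityFamily ν P p)
    (hdiff : ∀ᵐ z ∂ν, Differentiable ℝ (fun θ => p θ z))
    {θ : EuclideanSpace ℝ (Fin d)} (hJ : FisherMatrixExists P p θ)
    (h : EuclideanSpace ℝ (Fin d)) :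
    ∫⁻ z, ENNReal.ofReal (fderiv ℝ (fun t => p t z) θ h ^ 2 / (4 * p θ z)) ∂ν =
      ENNReal.ofReal ((∑ i, ∑ j, h i * h j * fisherMatrix P p θ i j) / 4) := by
  obtain ⟨hpm, hp0, hP⟩ := hPp
  have hsq (z : Z) : (∑ i, h i * score p θ i z) ^ 2 / 4 =
      (∑ i, ∑ j, h i * h j * (score p θ i z * score p θ j z)) / 4 := by
    rw [sq, Finset.sum_mul_sum]
    congr 1
    exact Finset.sum_congr rfl fun i _ => Finset.sum_congr rfl fun j _ => by ring
  have hint : Integrable (fun z => (∑ i, h i * score p θ i z) ^ 2 / 4)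
      (P θ : Measure Z) := by
    simp only [hsq]
    exact (integrable_finsetSum _ fun i _ => integrable_finsetSum _ fun j _ =>
      (hJ i j).const_mul _).div_const 4
  have hval : ∫ z, (∑ i, h i * score p θ i z) ^ 2 / 4 ∂(P θ : Measure Z) =
      (∑ i, ∑ j, h i * h j * fisherMatrix P p θ i j) / 4 := by
    simp only [hsq]
    rw [integral_div, integral_finsetSum _ fun i _ => integrable_finsetSum _ fun j _ =>
      (hJ i j).const_mul _]
    congr 1
    refine Finset.sum_congr rfl fun i _ => ?_
    rw [integral_finsetSum _ fun j _ => (hJ i j).const_mul _]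
    exact Finset.sum_congr rfl fun j _ => by rw [integral_const_mul]; rfl
  rw [← hval, ofReal_integral_eq_lintegral_ofReal hint
    (Eventually.of_forall fun z => by positivity), hP θ,
    lintegral_withDensity_eq_lintegral_mul_non_measurable₀ _
      (hpm θ).ennreal_ofReal.aemeasurable (Eventually.of_forall fun z => ENNReal.ofReal_lt_top)]
  refine lintegral_congr_ae ?_
  filter_upwards [hdiff] with z hz
  rw [Pi.mul_apply, ← ENNReal.ofReal_mul (hp0 θ z)]
  -- At zeros of the density both sides vanish: the left by division by zero, the right by its
  -- weight.
  rcases eq_or_ne (p θ z) 0 with h0 | h0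
  · simp [h0]
  · rw [fderiv_eq_sum_score (hz θ) h0 h]
    congr 1
    field_simp

theorem sum_fisherMatrix_pos [MeasurableSpace Z] {P : EuclideanSpace ℝ (Fin d) → ProbabilityMeasure Z}
    {p : EuclideanSpace ℝ (Fin d) → Z → ℝ} {θ : EuclideanSpace ℝ (Fin d)}
    (hJ : (fisherMatrix P p θ).PosDef) {h : EuclideanSpace ℝ (Fin d)} (hh : h ≠ 0) :
    0 < ∑ i, ∑ j, h i * h j * fisherMatrix P p θ i j := by
  have h0 : (h.ofLp : Fin d → ℝ) ≠ 0 := fun h0 => hh (by ext i; exact congrFun h0 i)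
  refine (hJ.dotProduct_mulVec_pos h0).trans_eq ?_
  simp only [dotProduct, Matrix.mulVec, star_trivial, Finset.mul_sum]
  exact Finset.sum_congr rfl fun i _ => Finset.sum_congr rfl fun j _ => by ring

theorem sum_mul_mul_le_of_abs_le {J : Matrix (Fin d) (Fin d) ℝ} {C : ℝ}
    (hJ : ∀ i j, |J i j| ≤ C) (h : EuclideanSpace ℝ (Fin d)) :
    ∑ i, ∑ j, h i * h j * J i j ≤ d ^ 2 * C * ‖h‖ ^ 2 := by
  have hle (i j : Fin d) : h i * h j * J i j ≤ ‖h‖ * ‖h‖ * C := by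
    refine (le_abs_self _).trans ?_
    rw [abs_mul, abs_mul]
    have hi : |h i| ≤ ‖h‖ := PiLp.norm_apply_le h i
    have hj : |h j| ≤ ‖h‖ := PiLp.norm_apply_le h j
    have := hJ i j
    gcongr
  calc ∑ i, ∑ j, h i * h j * J i j ≤ ∑ _i : Fin d, ∑ _j : Fin d, ‖h‖ * ‖h‖ * C :=
        Finset.sum_le_sum fun i _ => Finset.sum_le_sum fun j _ => hle i j
    _ = d ^ 2 * C * ‖h‖ ^ 2 := by simp; ring

end Fisher

/-! ### Hellinger, L¹ and weak convergence. -/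

section DensityFamily

variable {Z Θ : Type*} [MeasurableSpace Z] {ν : Measure Z} {P : Θ → ProbabilityMeasure Z}
  {p : Θ → Z → ℝ}

theorem IsDensityFamily.lintegral_eq_one (hPp : IsDensityFamily ν P p) (θ : Θ) :
    ∫⁻ z, ENNReal.ofReal (p θ z) ∂ν = 1 := by
  have h := measure_univ (μ := (P θ : Measure Z))
  rwa [hPp.2.2 θ, withDensity_apply _ MeasurableSet.univ, Measure.restrict_univ] at h

theorem IsDensityFamily.integrable (hPp : IsDensityFamily ν P p) (θ : Θ) :
    Integrable (p θ) ν := by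
  refine ⟨(hPp.1 θ).aestronglyMeasurable, ?_⟩
  rw [hasFiniteIntegral_iff_ofReal (Eventually.of_forall (hPp.2.1 θ)), hPp.lintegral_eq_one θ]
  exact ENNReal.one_lt_top

theorem IsDensityFamily.integral_eq_one (hPp : IsDensityFamily ν P p) (θ : Θ) :
    ∫ z, p θ z ∂ν = 1 := by
  rw [integral_eq_lintegral_of_nonneg_ae (Eventually.of_forall (hPp.2.1 θ))
    (hPp.1 θ).aestronglyMeasurable, hPp.lintegral_eq_one θ, ENNReal.toReal_one]

theorem IsDensityFamily.integrable_sq_sqrt_sub_sqrt (hPp : IsDensityFamily ν P p) (θ θ' : Θ) :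
    Integrable (fun z => (√(p θ z) - √(p θ' z)) ^ 2) ν := by
  refine ((hPp.integrable θ).add (hPp.integrable θ')).mono' ?_ (Eventually.of_forall fun z => ?_)
  · exact (((hPp.1 θ).sqrt.sub (hPp.1 θ').sqrt).pow_const 2).aestronglyMeasurable
  · rw [Real.norm_of_nonneg (sq_nonneg _), Pi.add_apply]
    nlinarith [Real.sq_sqrt (hPp.2.1 θ z), Real.sq_sqrt (hPp.2.1 θ' z),
      mul_nonneg (Real.sqrt_nonneg (p θ z)) (Real.sqrt_nonneg (p θ' z))]

theorem hellingerSq_nonneg (ν : Measure Z) (p : Θ → Z → ℝ) (θ θ' : Θ) :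
    0 ≤ hellingerSq ν p θ θ' :=
  integral_nonneg fun _ => sq_nonneg _

theorem IsDensityFamily.ofReal_hellingerSq (hPp : IsDensityFamily ν P p) (θ θ' : Θ) :
    ENNReal.ofReal (hellingerSq ν p θ θ') =
      ∫⁻ z, ENNReal.ofReal ((√(p θ z) - √(p θ' z)) ^ 2) ∂ν :=
  ofReal_integral_eq_lintegral_ofReal (hPp.integrable_sq_sqrt_sub_sqrt θ θ')
    (Eventually.of_forall fun _ => sq_nonneg _)

/-- Factor `|x² - y²| = |x - y| (x + y)` and apply weighted AM–GM pointwise. The constant is `1/2`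
from the Hellinger term plus `2` from the two unit masses. -/
theorem IsDensityFamily.integral_abs_sub_le (hPp : IsDensityFamily ν P p) {θ θ' : Θ} {η : ℝ}
    (hη : 0 < η) (h : hellingerSq ν p θ θ' ≤ η ^ 2) :
    ∫ z, |p θ z - p θ' z| ∂ν ≤ 5 / 2 * η := by
  have hi := hPp.integrable_sq_sqrt_sub_sqrt θ θ'
  have hs : Integrable (fun z => p θ z + p θ' z) ν := (hPp.integrable θ).add (hPp.integrable θ')
  have hle (z : Z) : |p θ z - p θ' z| ≤
      (2 * η)⁻¹ * (√(p θ z) - √(p θ' z)) ^ 2 + η * (p θ z + p θ' z) := by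
    have e1 := Real.sq_sqrt (hPp.2.1 θ z)
    have e2 := Real.sq_sqrt (hPp.2.1 θ' z)
    set x := √(p θ z)
    set y := √(p θ' z)
    have hx : 0 ≤ x := Real.sqrt_nonneg _
    have hy : 0 ≤ y := Real.sqrt_nonneg _
    have hfac : |p θ z - p θ' z| = |x - y| * (x + y) := by
      rw [← e1, ← e2, sq_sub_sq, abs_mul, abs_of_nonneg (add_nonneg hx hy), mul_comm]
    have key : 2 * η * (|x - y| * (x + y)) ≤ |x - y| ^ 2 + 2 * η ^ 2 * (x ^ 2 + y ^ 2) := by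
      nlinarith [sq_nonneg (|x - y| - η * (x + y)), mul_nonneg (sq_nonneg η) (sq_nonneg (x - y))]
    rw [sq_abs] at key
    rw [hfac, ← e1, ← e2]
    calc |x - y| * (x + y) = (2 * η)⁻¹ * (2 * η * (|x - y| * (x + y))) := by field_simp
      _ ≤ (2 * η)⁻¹ * ((x - y) ^ 2 + 2 * η ^ 2 * (x ^ 2 + y ^ 2)) := by gcongr
      _ = _ := by field_simp
  calc ∫ z, |p θ z - p θ' z| ∂ν
      ≤ ∫ z, ((2 * η)⁻¹ * (√(p θ z) - √(p θ' z)) ^ 2 + η * (p θ z + p θ' z)) ∂ν :=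
        integral_mono ((hPp.integrable θ).sub (hPp.integrable θ')).abs
          ((hi.const_mul _).add (hs.const_mul _)) hle
    _ = (2 * η)⁻¹ * hellingerSq ν p θ θ' + η * (1 + 1) := by
        rw [integral_add (hi.const_mul _) (hs.const_mul _), integral_const_mul,
          integral_const_mul, integral_add (hPp.integrable θ) (hPp.integrable θ'),
          hPp.integral_eq_one, hPp.integral_eq_one]
        rfl
    _ ≤ (2 * η)⁻¹ * η ^ 2 + η * (1 + 1) := by gcongr
    _ = 5 / 2 * η := by field_simp; ring

/-- Integrals of a bounded continuous `f` differ by at most `‖f‖` times the L¹ distance of the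
densities. -/
theorem IsDensityFamily.tendsto_of_hellingerSq_tendsto [TopologicalSpace Z]
    [OpensMeasurableSpace Z] (hPp : IsDensityFamily ν P p) {θ : Θ} {u : ℕ → Θ}
    (h : Tendsto (fun n => hellingerSq ν p θ (u n)) atTop (𝓝 0)) :
    Tendsto (fun n => P (u n)) atTop (𝓝 (P θ)) := by
  rw [ProbabilityMeasure.tendsto_iff_forall_integral_tendsto]
  intro f
  have hexp (θ : Θ) : ∫ z, f z ∂(P θ : Measure Z) = ∫ z, p θ z * f z ∂ν := by
    rw [hPp.2.2 θ, integral_withDensity_eq_integral_toReal_smul (hPp.1 θ).ennreal_ofReal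
      (Eventually.of_forall fun _ => ENNReal.ofReal_lt_top)]
    simp [ENNReal.toReal_ofReal (hPp.2.1 θ _)]
  have hfi (θ : Θ) : Integrable (fun z => p θ z * f z) ν :=
    (hPp.integrable θ).mul_bdd (c := ‖f‖) f.continuous.aestronglyMeasurable
      (Eventually.of_forall f.norm_coe_le_norm)
  have hdist {θ' : Θ} {η : ℝ} (hη : 0 < η) (hle : hellingerSq ν p θ θ' ≤ η ^ 2) :
      |∫ z, f z ∂(P θ' : Measure Z) - ∫ z, f z ∂(P θ : Measure Z)| ≤ ‖f‖ * (5 / 2 * η) := by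
    rw [hexp, hexp, abs_sub_comm, ← integral_sub (hfi θ) (hfi θ'), ← Real.norm_eq_abs]
    refine (norm_integral_le_of_norm_le (((hPp.integrable θ).sub
      (hPp.integrable θ')).abs.const_mul ‖f‖) (Eventually.of_forall fun z => ?_)).trans ?_
    · rw [← sub_mul, norm_mul, mul_comm, Real.norm_eq_abs (p θ z - p θ' z)]
      exact mul_le_mul_of_nonneg_right (f.norm_coe_le_norm z) (abs_nonneg _)
    · rw [integral_const_mul]
      exact mul_le_mul_of_nonneg_left (hPp.integral_abs_sub_le hη hle) (norm_nonneg f)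
  rw [Metric.tendsto_atTop']
  intro ε hε
  -- The `+ 1` covers `f = 0` and makes the final inequality strict.
  set η : ℝ := ε / (5 / 2 * (‖f‖ + 1)) with hη_def
  have hη : 0 < η := by positivity
  obtain ⟨N, hN⟩ := eventually_atTop.1 (h.eventually_lt_const (pow_pos hη 2))
  refine ⟨N, fun n hn => (hdist hη (hN n hn.le).le).trans_lt ?_⟩
  calc ‖f‖ * (5 / 2 * η) < (‖f‖ + 1) * (5 / 2 * η) := by gcongr; linarith
    _ = ε := by rw [hη_def]; field_simp

/-- Hellinger balls are small for the topology of the parameter space. -/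
theorem InverseWeaklyContinuous.exists_hellingerSq_le_imp_mem [TopologicalSpace Z]
    [OpensMeasurableSpace Z] [TopologicalSpace Θ] (hcont : InverseWeaklyContinuous P)
    (hPp : IsDensityFamily ν P p) {θ : Θ} {U : Set Θ} (hU : U ∈ 𝓝 θ) :
    ∃ ε : ℝ, 0 < ε ∧ ∀ θ', √(hellingerSq ν p θ θ') ≤ ε → θ' ∈ U := by
  by_contra! hcon
  choose u hu hnot using fun n : ℕ => hcon (1 / ((n : ℝ) + 1)) Nat.one_div_pos_of_nat
  have hsqrt : Tendsto (fun n => √(hellingerSq ν p θ (u n))) atTop (𝓝 0) :=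
    squeeze_zero (fun n => Real.sqrt_nonneg _) hu tendsto_one_div_add_atTop_nhds_zero_nat
  have hsq : Tendsto (fun n => hellingerSq ν p θ (u n)) atTop (𝓝 0) := by
    simpa [Real.sq_sqrt (hellingerSq_nonneg ν p θ _)] using hsqrt.pow 2
  obtain ⟨n, hn⟩ := ((hcont θ u (hPp.tendsto_of_hellingerSq_tendsto hsq)).eventually_mem hU).exists
  exact hnot n hn

end DensityFamily

/-! ### Two-sided bounds near a parameter. -/

section Local

variable {Z : Type*} [MeasurableSpace Z] {d : ℕ} {ν : Measure Z}
  {P : EuclideanSpace ℝ (Fin d) → ProbabilityMeasure Z} {p : EuclideanSpace ℝ (Fin d) → Z → ℝ}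

/-- Balls are convex, so the whole segment stays where the entries of `J` are bounded by `C`. -/
theorem hellingerSq_le_of_fisherMatrix_bounded [SFinite ν] (hPp : IsDensityFamily ν P p)
    (hdiff : ∀ᵐ z ∂ν, Differentiable ℝ (fun θ => p θ z))
    (hJ_exists : ∀ θ, FisherMatrixExists P p θ) {θ θ' : EuclideanSpace ℝ (Fin d)} {C δ : ℝ}
    (hC : ∀ θ' ∈ Metric.ball θ δ, ∀ i j, |fisherMatrix P p θ' i j| ≤ C)
    (hC0 : 0 ≤ C) (hθ' : θ' ∈ Metric.ball θ δ) :
    hellingerSq ν p θ θ' ≤ d ^ 2 * C * ‖θ - θ'‖ ^ 2 / 4 := by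
  have hθ : θ ∈ Metric.ball θ δ := Metric.mem_ball_self (Metric.pos_of_mem_ball hθ')
  rw [← ENNReal.ofReal_le_ofReal_iff (by positivity), hPp.ofReal_hellingerSq]
  have hle := lintegral_sq_sqrt_sub_sqrt_le hPp.1 hPp.2.1 hdiff θ (θ' - θ)
  rw [add_sub_cancel] at hle
  refine hle.trans ?_
  calc _ ≤ ∫⁻ t in Set.Ioc (0 : ℝ) 1, ENNReal.ofReal (d ^ 2 * C * ‖θ - θ'‖ ^ 2 / 4) := by
        refine setLIntegral_mono measurable_const fun t ht => ?_
        rw [lintegral_fderiv_sq_div_eq_fisher hPp hdiff (hJ_exists _), norm_sub_rev]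
        have hmem := (convex_ball θ δ).add_smul_sub_mem hθ hθ' ⟨ht.1.le, ht.2⟩
        exact ENNReal.ofReal_le_ofReal
          (div_le_div_of_nonneg_right (sum_mul_mul_le_of_abs_le (hC _ hmem) _) (by norm_num))
    _ = _ := by simp

/-- Fatou's lemma along difference quotients of the square root of the density. -/
theorem lintegral_fderiv_sq_div_le_liminf (hPp : IsDensityFamily ν P p)
    (hdiff : ∀ᵐ z ∂ν, Differentiable ℝ (fun θ => p θ z)) {θ v : EuclideanSpace ℝ (Fin d)}
    {c : ℕ → ℝ} {h : ℕ → EuclideanSpace ℝ (Fin d)} (hh : Tendsto h atTop (𝓝 0))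
    (hch : Tendsto (fun n => c n • h n) atTop (𝓝 v)) :
    ∫⁻ z, ENNReal.ofReal (fderiv ℝ (fun t => p t z) θ v ^ 2 / (4 * p θ z)) ∂ν ≤
      liminf (fun n => ENNReal.ofReal (c n ^ 2 * hellingerSq ν p θ (θ + h n))) atTop := by
  have hH (n : ℕ) : ENNReal.ofReal (c n ^ 2 * hellingerSq ν p θ (θ + h n)) =
      ∫⁻ z, ENNReal.ofReal ((c n • (√(p (θ + h n) z) - √(p θ z))) ^ 2) ∂ν := by
    have hmeas : Measurable fun z => ENNReal.ofReal ((√(p θ z) - √(p (θ + h n) z)) ^ 2) :=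
      (((hPp.1 θ).sqrt.sub (hPp.1 (θ + h n)).sqrt).pow_const 2).ennreal_ofReal
    rw [ENNReal.ofReal_mul (sq_nonneg _), hPp.ofReal_hellingerSq, ← lintegral_const_mul _ hmeas]
    refine lintegral_congr fun z => ?_
    rw [← ENNReal.ofReal_mul (sq_nonneg _), smul_eq_mul, mul_pow, sub_sq_comm]
  simp only [hH]
  refine le_trans (lintegral_mono_ae ?_) (lintegral_liminf_le fun n =>
    ((((hPp.1 (θ + h n)).sqrt.sub (hPp.1 θ).sqrt).const_smul (c n)).pow_const 2).ennreal_ofReal)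
  filter_upwards [hdiff] with z hz
  -- Where the density vanishes the left integrand is `0`, so `√p` is differentiated only where `p`
  -- is positive.
  rcases eq_or_ne (p θ z) 0 with h0 | h0
  · simp [h0]
  have hlim := ((hz θ).hasFDerivAt.sqrt h0).hasFDerivWithinAt (s := Set.univ) |>.lim hh
    (Eventually.of_forall fun _ => Set.mem_univ _) hch
  have hlim' := ENNReal.tendsto_ofReal (hlim.pow 2)
  rw [hlim'.liminf_eq]
  refine (congrArg ENNReal.ofReal ?_).le
  simp only [smul_apply, smul_eq_mul, mul_pow, div_pow,
    Real.sq_sqrt (hPp.2.1 θ z)]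
  field_simp
  norm_num

/-- Compactness of the unit sphere turns failure of every constant into one direction of zero Fisher
information. -/
theorem exists_mul_norm_sq_le_hellingerSq (hPp : IsDensityFamily ν P p)
    (hdiff : ∀ᵐ z ∂ν, Differentiable ℝ (fun θ => p θ z)) {θ : EuclideanSpace ℝ (Fin d)}
    (hJ : FisherMatrixExists P p θ) (hJ_pos : (fisherMatrix P p θ).PosDef) :
    ∃ c : ℝ, 0 < c ∧ ∀ᶠ θ' in 𝓝 θ, c * ‖θ - θ'‖ ^ 2 ≤ hellingerSq ν p θ θ' := by
  by_contra! hcon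
  have hex (n : ℕ) : ∃ h : EuclideanSpace ℝ (Fin d), ‖h‖ < 1 / ((n : ℝ) + 1) ∧
      hellingerSq ν p θ (θ + h) < 1 / ((n : ℝ) + 1) * ‖h‖ ^ 2 := by
    have hpos : (0 : ℝ) < 1 / ((n : ℝ) + 1) := Nat.one_div_pos_of_nat
    obtain ⟨θ', hθ', hlt⟩ :=
      ((hcon _ hpos).and_eventually (Metric.ball_mem_nhds θ hpos)).exists
    refine ⟨θ' - θ, by simpa [dist_eq_norm] using hlt, ?_⟩
    rw [add_sub_cancel, norm_sub_rev]
    exact hθ'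
  choose h hsmall hlt using hex
  -- The strict inequality in `hlt` excludes `h n = 0`, so normalising is legitimate.
  have hne (n : ℕ) : 0 < ‖h n‖ := by
    rw [norm_pos_iff]
    intro h0
    have := hlt n
    have := hellingerSq_nonneg ν p θ (θ + h n)
    simp_all only [norm_zero]
    norm_num at *
    linarith
  obtain ⟨v, hv, φ, hφ, hlim⟩ := (isCompact_sphere (0 : EuclideanSpace ℝ (Fin d)) 1).tendsto_subseq
    (x := fun n => ‖h n‖⁻¹ • h n) (fun n => by
      rw [mem_sphere_zero_iff_norm, norm_smul, norm_inv, norm_norm,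
        inv_mul_cancel₀ (hne n).ne'])
  have hh0 : Tendsto (fun n => h (φ n)) atTop (𝓝 0) :=
    (squeeze_zero_norm (fun n => (hsmall n).le) tendsto_one_div_add_atTop_nhds_zero_nat).comp
      hφ.tendsto_atTop
  have hfatou := lintegral_fderiv_sq_div_le_liminf hPp hdiff (θ := θ) hh0 hlim
  have hzero : Tendsto (fun n => ENNReal.ofReal
      (‖h (φ n)‖⁻¹ ^ 2 * hellingerSq ν p θ (θ + h (φ n)))) atTop (𝓝 0) := by
    rw [← ENNReal.ofReal_zero]
    refine ENNReal.tendsto_ofReal (squeeze_zero (fun n => mul_nonneg (sq_nonneg _)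
      (hellingerSq_nonneg _ _ _ _)) (fun n => ?_)
      ((tendsto_one_div_add_atTop_nhds_zero_nat (𝕜 := ℝ)).comp hφ.tendsto_atTop))
    have hn := hne (φ n)
    calc ‖h (φ n)‖⁻¹ ^ 2 * hellingerSq ν p θ (θ + h (φ n))
        ≤ ‖h (φ n)‖⁻¹ ^ 2 * (1 / ((φ n : ℝ) + 1) * ‖h (φ n)‖ ^ 2) := by
          gcongr
          exact (hlt (φ n)).le
      _ = 1 / ((φ n : ℝ) + 1) := by field_simp
  rw [hzero.liminf_eq, lintegral_fderiv_sq_div_eq_fisher hPp hdiff hJ, nonpos_iff_eq_zero,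
    ENNReal.ofReal_eq_zero] at hfatou
  have hv0 : v ≠ 0 := by
    rintro rfl
    simp at hv
  linarith [sum_fisherMatrix_pos hJ_pos hv0]

end Local

theorem theorem5 {Z : Type*} [MetricSpace Z] [CompleteSpace Z]
    [TopologicalSpace.SeparableSpace Z] [MeasurableSpace Z] [BorelSpace Z]
    (ν : Measure Z) [SigmaFinite ν] (a b : ℕ)
    (P : EuclideanSpace ℝ (Fin (a + b)) → ProbabilityMeasure Z)
    (p : EuclideanSpace ℝ (Fin (a + b)) → Z → ℝ)
    (hPp : IsDensityFamily ν P p)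
    (hcont : InverseWeaklyContinuous P)
    (hdiff : ∀ᵐ z ∂ν, Differentiable ℝ (fun θ => p θ z))
    (hJ_exists : ∀ θ, FisherMatrixExists P p θ)
    (hJ_bdd : ∀ θ₀, ∃ C : ℝ, ∀ᶠ θ in 𝓝 θ₀, ∀ i j, |fisherMatrix P p θ i j| ≤ C)
    (hJ_pos : ∀ θ, (fisherMatrix P p θ).PosDef) :
    LocallyDominates (fun θ θ' => ‖θ - θ'‖) (fun θ θ' => √(hellingerSq ν p θ θ')) := by
  intro θ
  obtain ⟨C, hC⟩ := hJ_bdd θ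
  obtain ⟨δ, hδ, hball⟩ := Metric.eventually_nhds_iff_ball.1 hC
  obtain ⟨c, hc, hlower⟩ := exists_mul_norm_sq_le_hellingerSq hPp hdiff (hJ_exists θ) (hJ_pos θ)
  obtain ⟨ε, hε, hnear⟩ := hcont.exists_hellingerSq_le_imp_mem hPp
    (inter_mem hlower (Metric.ball_mem_nhds θ hδ))
  -- `|C|` is used because the sign of `C` is not given; `K + 1` below keeps the upper constant
  -- positive even when `K = 0`.
  set K : ℝ := ((a + b : ℕ) : ℝ) ^ 2 * |C| / 4 with hK
  refine ⟨ε, √c, √(K + 1), hε, Real.sqrt_pos.2 hc, Real.sqrt_pos.2 (by positivity),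
    fun θ' hθ' => ?_⟩
  obtain ⟨hlow, hmem⟩ := hnear θ' hθ'
  have hup := hellingerSq_le_of_fisherMatrix_bounded hPp hdiff hJ_exists
    (fun θ' h i j => (hball θ' h i j).trans (le_abs_self C)) (abs_nonneg C) hmem
  have hsqrt (x : ℝ) (hx : 0 ≤ x) : √x * ‖θ - θ'‖ = √(x * ‖θ - θ'‖ ^ 2) := by
    rw [Real.sqrt_mul hx, Real.sqrt_sq (norm_nonneg _)]
  constructor
  · simp only [hsqrt c hc.le]
    exact Real.sqrt_le_sqrt hlow
  · simp only [hsqrt (K + 1) (by positivity)]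
    refine Real.sqrt_le_sqrt (hup.trans ?_)
    rw [hK]
    nlinarith [sq_nonneg ‖θ - θ'‖]
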